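/- Let $h,k\ge 1$ be integers and let $q$ be a prime power with $q\ge hk+1$. For a finite field $\mathbb F$, a normal rational curve of $\mathrm{PG}(hk-1,\mathbb F)$ is a set of points of the form $$\{\langle (g_0(u,t),\ldots,g_{hk-1}(u,t))\rangle_{\mathbb F} : (u,t)\in\mathbb F^2\setminus\{(0,0)\}\},$$ where $g_0,\ldots,g_{hk-1}$ is a basis of the $\mathbb F$-vector space of homogeneous polynomials of degree $hk-1$ in $\mathbb F[x,y]$. In $\mathrm{PG}(hk-1,q^h)$ let $$\Sigma=\{\langle (x_1,\ldots,x_{hk})\rangle_{\mathbb F_{q^h}} : (x_1,\ldots,x_{hk})\in\mathbb F_q^{hk}\setminus\{0\}\}$$ be the canonical subgeometry, identified with $\mathrm{PG}(hk-1,q)$ via $\langle x\rangle_{\mathbb F_q}\mapsto\langle x\rangle_{\mathbb F_{q^h}}$, and let $\Psi$ be the collineation $\langle (x_1,\ldots,x_{hk})\rangle_{\mathbb F_{q^h}}\mapsto\langle (x_1^q,\ldots,x_{hk}^q)\rangle_{\mathbb F_{q^h}}$. Let $\mathcal N$ be a normal rational curve of $\mathrm{PG}(hk-1,q^h)$. Then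 $\mathcal N\cap\Sigma$ is a normal rational curve of $\Sigma\cong\mathrm{PG}(hk-1,q)$ if and only if $\mathcal N^{\Psi}=\mathcal N$. -/

import Mathlib

open scoped LinearAlgebra.Projectivization

namespace NRC

/-- If `g` is a basis of the space of binary forms of degree `n - 1`, then the forms `g i` have no
common zero except the origin. -/
theorem eval_basis_ne_zero {K : Type*} [Field K] {n : ℕ}
    (g : Module.Basis (Fin n) K (MvPolynomial.homogeneousSubmodule (Fin 2) K (n - 1)))
    (v : Fin 2 → K) (hv : v ≠ 0) :
    (fun i => MvPolynomial.eval v (g i : MvPolynomial (Fin 2) K)) ≠ 0 := by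
  intro h0
  have hall : ∀ p : MvPolynomial.homogeneousSubmodule (Fin 2) K (n - 1),
      MvPolynomial.eval v (p : MvPolynomial (Fin 2) K) = 0 := by
    intro p
    have hp := congrArg (fun x : MvPolynomial.homogeneousSubmodule (Fin 2) K (n - 1) =>
      MvPolynomial.eval v (x : MvPolynomial (Fin 2) K)) (g.sum_repr p)
    simp only [Submodule.coe_sum, Submodule.coe_smul, map_sum, MvPolynomial.smul_eval] at hp
    rw [← hp]
    exact Finset.sum_eq_zero fun i _ => by rw [show _ = (0 : K) from congrFun h0 i, mul_zero]
  obtain ⟨j, hj⟩ := Function.ne_iff.mp hv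
  have hX : MvPolynomial.X j ^ (n - 1) ∈ MvPolynomial.homogeneousSubmodule (Fin 2) K (n - 1) := by
    rw [MvPolynomial.mem_homogeneousSubmodule]
    exact MvPolynomial.isHomogeneous_X_pow j (n - 1)
  have := hall ⟨_, hX⟩
  simp only [map_pow, MvPolynomial.eval_X] at this
  exact pow_ne_zero (n - 1) hj this

/-- The set of points `⟨(g₀(u,t), …, gₙ₋₁(u,t))⟩` of `PG(n-1, K)`, `(u,t) ≠ (0,0)`, for a basis `g`
of the space of binary forms of degree `n - 1`. -/
def curve {K : Type*} [Field K] {n : ℕ}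
    (g : Module.Basis (Fin n) K (MvPolynomial.homogeneousSubmodule (Fin 2) K (n - 1))) :
    Set (ℙ K (Fin n → K)) :=
  {P | ∃ (v : Fin 2 → K) (hv : v ≠ 0),
    P = Projectivization.mk K (fun i => MvPolynomial.eval v (g i : MvPolynomial (Fin 2) K))
      (eval_basis_ne_zero g v hv)}

/-- `N` is a normal rational curve of `PG(n-1, K)`. -/
def IsNormalRationalCurve {K : Type*} [Field K] {n : ℕ} (N : Set (ℙ K (Fin n → K))) : Prop :=
  ∃ g : Module.Basis (Fin n) K (MvPolynomial.homogeneousSubmodule (Fin 2) K (n - 1)), N = curve g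

section

variable (F K : Type*) [Field F] [Field K] [Algebra F K] (n : ℕ)

/-- The inclusion `Fⁿ → Kⁿ`, semilinear over `F → K`. -/
def inclusion : (Fin n → F) →ₛₗ[algebraMap F K] (Fin n → K) where
  toFun x := fun i => algebraMap F K (x i)
  map_add' x y := by ext i; simp
  map_smul' a x := by ext i; simp

theorem inclusion_injective : Function.Injective (inclusion F K n) := fun x y hxy =>
  funext fun i => (algebraMap F K).injective (congrFun hxy i)

/-- The canonical embedding `PG(n-1, F) → PG(n-1, K)`, `⟨x⟩_F ↦ ⟨x⟩_K`. -/
def subgeometryEmbedding : ℙ F (Fin n → F) → ℙ K (Fin n → K) :=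
  Projectivization.map (inclusion F K n) (inclusion_injective F K n)

/-- The canonical subgeometry `Σ`: the points of `PG(n-1, K)` spanned by a nonzero vector with
coordinates in `F`. -/
def subgeometry : Set (ℙ K (Fin n → K)) := Set.range (subgeometryEmbedding F K n)

variable [Fintype F]

/-- The map `(x₁, …, xₙ) ↦ (x₁^q, …, xₙ^q)` on `Kⁿ`, `q = |F|`, semilinear over `x ↦ x^q`. -/
def frobeniusVec :
    (Fin n → K) →ₛₗ[(FiniteField.frobeniusAlgHom F K : K →+* K)] (Fin n → K) where
  toFun x := fun i => x i ^ Fintype.card F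
  map_add' x y := by
    ext i
    exact map_add (FiniteField.frobeniusAlgHom F K) (x i) (y i)
  map_smul' a x := by
    ext i
    exact map_mul (FiniteField.frobeniusAlgHom F K) a (x i)

theorem frobeniusVec_injective : Function.Injective (frobeniusVec F K n) := fun x y hxy =>
  funext fun i => (FiniteField.frobeniusAlgHom F K).injective (congrFun hxy i)

/-- The Frobenius collineation `Ψ : ⟨(x₁, …, xₙ)⟩ ↦ ⟨(x₁^q, …, xₙ^q)⟩` of `PG(n-1, K)`,
where `q = |F|`. -/
def frobeniusCollineation : ℙ K (Fin n → K) → ℙ K (Fin n → K) :=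
  Projectivization.map (frobeniusVec F K n) (frobeniusVec_injective F K n)

end

end NRC

/-!
A normal rational curve determines its basis of forms up to a projectivity of the parameter line
and a scalar: if all points of one curve of degree `d` at `d + 3` distinct parameters lie on a
second one, the linear map between the two spaces of forms preserves the cross ratios of these
parameters, hence is a multiple of a substitution. The `q + 1` points which a normal rational curve
of `Σ` provides are enough for this, so `𝒩` is the extension of `𝒩 ∩ Σ` as soon as the latter is a
normal rational curve, and such extensions are invariant under `Ψ`. Conversely, if `𝒩` is invariant
under `Ψ`, comparing the basis with its Frobenius conjugate gives a Frobenius-semilinear bijection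
of the parameter plane. By Galois descent it becomes, after a change of the parameter, a multiple of
the Frobenius map itself; the basis of `𝒩` can then be scaled so that its coefficients lie in `𝔽_q`,
and the points of `𝒩` in `Σ` are those with parameters in `PG(1, q)`.
-/

namespace NRC

open MvPolynomial

section Bracket

variable {R K ι : Type*} [CommRing R] [Field K]

/-- The determinant of two vectors of the plane: over a field it vanishes exactly when they are
linearly dependent, so it detects equality of points of the projective line. -/
def bracket (v w : Fin 2 → R) : R := v 0 * w 1 - v 1 * w 0

theorem bracket_self (v : Fin 2 → R) : bracket v v = 0 := by
  unfold bracket; ring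

theorem bracket_swap (v w : Fin 2 → R) : bracket v w = -bracket w v := by
  unfold bracket; ring

theorem ne_zero_of_bracket_ne_zero {v w : Fin 2 → R} (h : bracket v w ≠ 0) : v ≠ 0 := by
  rintro rfl; simp [bracket] at h

theorem exists_eq_smul_of_bracket_eq_zero {v w : Fin 2 → K} (hw : w ≠ 0) (h : bracket v w = 0) :
    ∃ a : K, v = a • w := by
  obtain ⟨i, hi⟩ := Function.ne_iff.mp hw
  refine ⟨v i / w i, funext fun j => ?_⟩
  rw [Pi.smul_apply, smul_eq_mul, div_mul_eq_mul_div, eq_div_iff hi]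
  have h' : v 0 * w 1 = v 1 * w 0 := sub_eq_zero.mp h
  fin_cases i <;> fin_cases j <;> simp [h']

/-- The vectors `s i` represent distinct points of the projective line. -/
def PairwiseIndep (s : ι → Fin 2 → R) : Prop :=
  Pairwise fun i j => bracket (s i) (s j) ≠ 0

theorem PairwiseIndep.ne_zero [Nontrivial ι] {s : ι → Fin 2 → R} (hs : PairwiseIndep s) (i : ι) :
    s i ≠ 0 :=
  have ⟨_, hj⟩ := exists_ne i
  ne_zero_of_bracket_ne_zero (hs hj.symm)

end Bracket

section Forms

variable {R : Type*} [CommRing R] {ι : Type*} {d : ℕ}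

/-- The space of binary forms of degree `d`. -/
abbrev Form (R : Type*) [CommRing R] (d : ℕ) : Submodule R (MvPolynomial (Fin 2) R) :=
  homogeneousSubmodule (Fin 2) R d

/-- Evaluation of binary forms of degree `d` at a vector, as a linear functional. -/
noncomputable def ev (v : Fin 2 → R) : Form R d →ₗ[R] R :=
  (aeval v).toLinearMap ∘ₗ (Form R d).subtype

theorem ev_apply (v : Fin 2 → R) (p : Form R d) : ev v p = eval v (p : MvPolynomial (Fin 2) R) :=
  rfl

theorem aeval_smul_of_isHomogeneous {σ A : Type*} [CommRing A] [Algebra R A]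
    {p : MvPolynomial σ R} (hp : p.IsHomogeneous d) (a : R) (f : σ → A) :
    aeval (a • f) p = a ^ d • aeval f p := by
  simp only [aeval_def, eval₂_eq, Finset.smul_sum]
  refine Finset.sum_congr rfl fun e he => ?_
  rw [hp.degree_eq_sum_deg_support he, ← Finset.prod_pow_eq_pow_sum]
  simp only [Pi.smul_apply, smul_pow, Finset.prod_smul, mul_smul_comm]

theorem ev_smul (a : R) (v : Fin 2 → R) (p : Form R d) : ev (a • v) p = a ^ d * ev v p :=
  aeval_smul_of_isHomogeneous p.2 a v

/-- The linear form `v ↦ bracket v s`, which vanishes at `s`. -/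
noncomputable def linForm (s : Fin 2 → R) : MvPolynomial (Fin 2) R :=
  C (s 1) * X 0 - C (s 0) * X 1

theorem isHomogeneous_linForm (s : Fin 2 → R) : (linForm s).IsHomogeneous 1 :=
  (isHomogeneous_C_mul_X _ _).sub (isHomogeneous_C_mul_X _ _)

theorem eval_linForm (s v : Fin 2 → R) : eval v (linForm s) = bracket v s := by
  simp only [linForm, bracket, map_sub, map_mul, eval_C, eval_X]; ring

/-- The product of the linear forms vanishing at the vectors `s i`, `i ∈ D`; the degree `d` is
passed as a proof `hD` so that it can be matched with the degree of other forms. -/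
noncomputable def prodForm (s : ι → Fin 2 → R) (D : Finset ι) (hD : D.card = d) : Form R d :=
  ⟨∏ i ∈ D, linForm (s i), by
    rw [mem_homogeneousSubmodule, ← hD]
    simpa using IsHomogeneous.prod D _ (fun _ => 1) fun i _ => isHomogeneous_linForm (s i)⟩

theorem ev_prodForm (s : ι → Fin 2 → R) (D : Finset ι) (hD : D.card = d) (v : Fin 2 → R) :
    ev v (prodForm s D hD) = ∏ i ∈ D, bracket v (s i) := by
  simp only [ev_apply, prodForm, map_prod, eval_linForm]

theorem ev_prodForm_eq_zero (s : ι → Fin 2 → R) {D : Finset ι} (hD : D.card = d) {i : ι}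
    (hi : i ∈ D) : ev (s i) (prodForm s D hD) = 0 := by
  rw [ev_prodForm, Finset.prod_eq_zero hi (bracket_self _)]

theorem PairwiseIndep.ev_prodForm_ne_zero [IsDomain R] {s : ι → Fin 2 → R} (hs : PairwiseIndep s)
    {D : Finset ι} (hD : D.card = d) {i : ι} (hi : i ∉ D) : ev (s i) (prodForm s D hD) ≠ 0 := by
  rw [ev_prodForm]
  exact Finset.prod_ne_zero_iff.mpr fun j hj => hs (ne_of_mem_of_not_mem hj hi).symm

/-- The basis of monomials of the space of binary forms of degree `d`, indexed by exponents. -/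
noncomputable def formBasis (R : Type*) [CommRing R] (d : ℕ) :
    Module.Basis {e : Fin 2 →₀ ℕ | e.degree = d} R (Form R d) :=
  (basisRestrictSupport R {e : Fin 2 →₀ ℕ | e.degree = d}).map
    (LinearEquiv.ofEq _ _ (homogeneousSubmodule_eq_finsupp_supported _ _ d).symm)

theorem formBasis_repr_apply (p : Form R d) (e : {e : Fin 2 →₀ ℕ | e.degree = d}) :
    (formBasis R d).repr p e = coeff e (p : MvPolynomial (Fin 2) R) := rfl

theorem coe_formBasis (e : {e : Fin 2 →₀ ℕ | e.degree = d}) :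
    (formBasis R d e : MvPolynomial (Fin 2) R) = monomial e 1 := by
  have h : (formBasis R d).repr ⟨monomial e 1, isHomogeneous_monomial 1 (by exact e.2)⟩ =
      Finsupp.single e 1 := by
    ext e'
    rw [formBasis_repr_apply, coeff_monomial, Finsupp.single_apply]
    simp only [Subtype.ext_iff]
  rw [← (formBasis R d).repr_symm_single_one, ← h, LinearEquiv.symm_apply_apply]

noncomputable instance : Fintype {e : Fin 2 →₀ ℕ | e.degree = d} :=
  Fintype.ofFinset (Finset.univ.finsuppAntidiag d) fun e => by
    simp [Finset.mem_finsuppAntidiag, Finsupp.degree_eq_sum]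

theorem card_degree_eq : Fintype.card {e : Fin 2 →₀ ℕ | e.degree = d} = d + 1 := by
  rw [Fintype.card_ofFinset, Finset.card_finsuppAntidiag_nat_eq_choose, Finset.card_univ,
    Fintype.card_fin]
  simp [Nat.add_comm 1 d]

instance : Module.Finite R (Form R d) := .of_basis (formBasis R d)

theorem finrank_form [Nontrivial R] : Module.finrank R (Form R d) = d + 1 := by
  rw [Module.finrank_eq_card_basis (formBasis R d), card_degree_eq]

end Forms

section Substitution

variable {R : Type*} [CommRing R] {d : ℕ}

/-- The form `p ∘ B`, obtained by substituting the linear map `B` of the plane into `p`. -/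
noncomputable def compMatrix (B : Matrix (Fin 2) (Fin 2) R) : Form R d →ₗ[R] Form R d :=
  (bind₁ B.toMvPolynomial).toLinearMap.restrict fun p hp => by
    have h := IsHomogeneous.aeval (n := 1) hp B.toMvPolynomial B.toMvPolynomial_isHomogeneous
    rwa [one_mul] at h

theorem coe_compMatrix (B : Matrix (Fin 2) (Fin 2) R) (p : Form R d) :
    (compMatrix B p : MvPolynomial (Fin 2) R) = bind₁ B.toMvPolynomial p := rfl

theorem ev_compMatrix (B : Matrix (Fin 2) (Fin 2) R) (p : Form R d) (v : Fin 2 → R) :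
    ev v (compMatrix B p) = ev (B.mulVec v) p := by
  rw [ev_apply, coe_compMatrix, eval, eval₂Hom_bind₁]
  exact congrArg (eval · (p : MvPolynomial (Fin 2) R))
    (funext fun i => B.toMvPolynomial_eval_eq_apply i v)

theorem compMatrix_one (p : Form R d) : compMatrix 1 p = p :=
  Subtype.ext <| by rw [coe_compMatrix, Matrix.toMvPolynomial_one, bind₁_X_left, AlgHom.id_apply]

theorem compMatrix_compMatrix (A B : Matrix (Fin 2) (Fin 2) R) (p : Form R d) :
    compMatrix A (compMatrix B p) = compMatrix (B * A) p :=
  Subtype.ext <| by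
    have h : (B * A).toMvPolynomial = fun i => bind₁ A.toMvPolynomial (B.toMvPolynomial i) :=
      funext (Matrix.toMvPolynomial_mul B A)
    rw [coe_compMatrix, coe_compMatrix, coe_compMatrix, bind₁_bind₁, h]

theorem compMatrix_smul (a : R) (B : Matrix (Fin 2) (Fin 2) R) (p : Form R d) :
    compMatrix (a • B) p = a ^ d • compMatrix B p := by
  have h : (a • B).toMvPolynomial = a • B.toMvPolynomial := by
    ext1 i
    simp [Matrix.toMvPolynomial, smul_monomial]
  exact Subtype.ext <| by
    rw [coe_compMatrix, h, Submodule.coe_smul, coe_compMatrix]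
    exact aeval_smul_of_isHomogeneous p.2 a _

/-- Substitution of an invertible matrix, as a linear equivalence. -/
noncomputable def compMatrixEquiv (B : Matrix (Fin 2) (Fin 2) R) (hB : IsUnit B.det) :
    Form R d ≃ₗ[R] Form R d :=
  LinearEquiv.ofLinearMap (compMatrix B) (compMatrix B⁻¹)
    (by ext1 p; simp [compMatrix_compMatrix, B.nonsing_inv_mul hB, compMatrix_one])
    (by ext1 p; simp [compMatrix_compMatrix, B.mul_nonsing_inv hB, compMatrix_one])

theorem compMatrixEquiv_apply (B : Matrix (Fin 2) (Fin 2) R) (hB : IsUnit B.det) (p : Form R d) :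
    compMatrixEquiv B hB p = compMatrix B p := rfl

end Substitution

section BaseChange

variable {R S T : Type*} [CommRing R] [CommRing S] [CommRing T] {d : ℕ}

/-- Base change of binary forms along a ring homomorphism, applied to the coefficients. -/
noncomputable def mapForm (φ : R →+* S) : Form R d →ₛₗ[φ] Form S d where
  toFun p := ⟨map φ (p : MvPolynomial (Fin 2) R), IsHomogeneous.map p.2 φ⟩
  map_add' p q := Subtype.ext (map_add (MvPolynomial.map φ) _ _)
  map_smul' a p := Subtype.ext <| by simp [smul_eq_C_mul]

theorem coe_mapForm (φ : R →+* S) (p : Form R d) :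
    (mapForm φ p : MvPolynomial (Fin 2) S) = map φ p := rfl

theorem ev_mapForm (φ : R →+* S) (p : Form R d) (v : Fin 2 → R) :
    ev (φ ∘ v) (mapForm φ p) = φ (ev v p) := by
  rw [ev_apply, ev_apply, coe_mapForm, map_eval]

theorem mapForm_mapForm (φ : R →+* S) (ψ : S →+* T) (p : Form R d) :
    mapForm ψ (mapForm φ p) = mapForm (ψ.comp φ) p :=
  Subtype.ext <| by rw [coe_mapForm, coe_mapForm, coe_mapForm, map_map]

theorem mapForm_compMatrix (φ : R →+* S) (B : Matrix (Fin 2) (Fin 2) R) (p : Form R d) :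
    mapForm φ (compMatrix B p) = compMatrix (B.map φ) (mapForm φ p) :=
  Subtype.ext <| by
    have h : (B.map φ).toMvPolynomial = fun i => MvPolynomial.map φ (B.toMvPolynomial i) :=
      funext (Matrix.toMvPolynomial_map φ B)
    rw [coe_mapForm, coe_compMatrix, coe_compMatrix, coe_mapForm, map_bind₁, h]

theorem mapForm_formBasis (φ : R →+* S) (e : {e : Fin 2 →₀ ℕ | e.degree = d}) :
    mapForm φ (formBasis R d e) = formBasis S d e :=
  Subtype.ext <| by rw [coe_mapForm, coe_formBasis, coe_formBasis, map_monomial, map_one]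

theorem exists_mapForm_eq {φ : R →+* S} {p : Form S d}
    (hp : ∀ e, (formBasis S d).repr p e ∈ φ.range) : ∃ r : Form R d, mapForm φ r = p := by
  choose y hy using hp
  refine ⟨∑ e, y e • formBasis R d e, ?_⟩
  simp only [map_sum, map_smulₛₗ, mapForm_formBasis, hy, (formBasis S d).sum_repr]

end BaseChange

section MapBasis

variable {F K : Type*} [Field F] [Field K] {ι : Type*} {d : ℕ}

theorem mapForm_mem_span (φ : F →+* K) (m : Module.Basis ι F (Form F d)) (p : Form F d) :
    mapForm φ p ∈ Submodule.span K (Set.range fun i => mapForm φ (m i)) := by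
  induction m.mem_span p using Submodule.span_induction with
  | mem _ h =>
    obtain ⟨i, rfl⟩ := h
    exact Submodule.subset_span (Set.mem_range_self i)
  | zero => simp
  | add p r _ _ hp hr => rw [map_add]; exact add_mem hp hr
  | smul a p _ hp => rw [map_smulₛₗ]; exact Submodule.smul_mem _ _ hp

theorem top_le_span_mapForm (φ : F →+* K) (m : Module.Basis ι F (Form F d)) :
    ⊤ ≤ Submodule.span K (Set.range fun i => mapForm φ (m i)) := by
  rw [← (formBasis K d).span_eq, Submodule.span_le]
  rintro _ ⟨e, rfl⟩
  rw [← mapForm_formBasis φ]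
  exact mapForm_mem_span φ m _

variable [Fintype ι]

/-- The basis of the space of binary forms over `K` obtained by base change from a basis over
`F`. -/
noncomputable def mapBasis (φ : F →+* K) (m : Module.Basis ι F (Form F d)) :
    Module.Basis ι K (Form K d) :=
  basisOfTopLeSpanOfCardEqFinrank _ (top_le_span_mapForm φ m) <| by
    rw [finrank_form, ← finrank_form (R := F), Module.finrank_eq_card_basis m]

theorem mapBasis_apply (φ : F →+* K) (m : Module.Basis ι F (Form F d)) (i : ι) :
    mapBasis φ m i = mapForm φ (m i) := by
  simp [mapBasis]

theorem exists_mapBasis_eq {φ : F →+* K} {g : Module.Basis ι K (Form K d)}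
    (hg : ∀ j, ∃ r, mapForm φ r = g j) : ∃ m, mapBasis φ m = g := by
  choose m hm using hg
  have hlin : LinearIndependent F m := by
    refine Fintype.linearIndependent_iff.mpr fun a ha j => ?_
    have h := congrArg (mapForm φ) ha
    simp only [map_sum, map_smulₛₗ, hm, map_zero] at h
    exact (map_eq_zero φ).mp (Fintype.linearIndependent_iff.mp g.linearIndependent _ h j)
  have : Nonempty ι := by
    rw [← Fintype.card_pos_iff, ← Module.finrank_eq_card_basis g, finrank_form]
    exact d.succ_pos
  refine ⟨basisOfLinearIndependentOfCardEqFinrank hlin ?_, ?_⟩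
  · rw [finrank_form, ← finrank_form (R := K), Module.finrank_eq_card_basis g]
  · exact Module.Basis.eq_of_apply_eq fun j => by simp [mapBasis_apply, hm]

end MapBasis

section Zeros

variable {K : Type*} [Field K] {ι : Type*} {d : ℕ}

theorem eq_zero_of_ev_eq_zero {s : ι → Fin 2 → K} (hs : PairwiseIndep s) {S : Finset ι}
    (hS : S.card = d + 1) {p : Form K d} (hp : ∀ i ∈ S, ev (s i) p = 0) : p = 0 := by
  classical
  -- Lagrange interpolation: evaluation at the points of `S` is surjective, hence injective.
  let E : Form K d →ₗ[K] (S → K) := LinearMap.pi fun i => ev (s i)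
  let D (i : S) : Finset ι := S.erase i
  have hcard (i : S) : (D i).card = d := by simp [D, Finset.card_erase_of_mem i.2, hS]
  have hE : Function.Surjective E := fun y => by
    refine ⟨∑ i, (y i / ev (s i) (prodForm s (D i) (hcard i))) • prodForm s (D i) (hcard i), ?_⟩
    ext k
    simp only [E, LinearMap.pi_apply, map_sum, map_smul, smul_eq_mul]
    rw [Finset.sum_eq_single_of_mem k (Finset.mem_univ k)]
    · exact div_mul_cancel₀ _ (hs.ev_prodForm_ne_zero _ (S.notMem_erase _))
    · intro i _ hik
      have hkD : (k : ι) ∈ D i :=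
        Finset.mem_erase.mpr ⟨fun h => hik (Subtype.ext h.symm), k.2⟩
      rw [ev_prodForm_eq_zero _ _ hkD, mul_zero]
  have hinj : Function.Injective E :=
    (LinearMap.injective_iff_surjective_of_finrank_eq_finrank
      (by simp [finrank_form, hS])).mpr hE
  exact hinj (funext fun i => by simpa [E] using hp i i.2)

end Zeros

section Uniqueness

variable {K : Type*} [Field K] {ι : Type*} {d : ℕ} {L : Form K d →ₗ[K] Form K d}
  {s t : ι → Fin 2 → K} {c : ι → K}

theorem exists_map_prodForm_eq_smul (hs : PairwiseIndep s)
    (hL : ∀ i p, ev (s i) (L p) = c i * ev (t i) p) {D : Finset ι} (hD : D.card = d)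
    {b : ι} (hb : b ∉ D) : ∃ κ : K, L (prodForm t D hD) = κ • prodForm s D hD := by
  classical
  -- Both sides vanish at `s i` for `i ∈ D`, and `κ` is chosen such that they agree at `s b`.
  refine ⟨ev (s b) (L (prodForm t D hD)) / ev (s b) (prodForm s D hD), sub_eq_zero.mp ?_⟩
  refine eq_zero_of_ev_eq_zero hs (S := insert b D) (by simp [hb, hD]) fun i hi => ?_
  rw [map_sub, map_smul, smul_eq_mul]
  rcases Finset.mem_insert.mp hi with rfl | hi
  · rw [div_mul_cancel₀ _ (hs.ev_prodForm_ne_zero hD hb), sub_self]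
  · rw [hL, ev_prodForm_eq_zero t hD hi, ev_prodForm_eq_zero s hD hi, mul_zero, mul_zero, sub_self]

theorem exists_card_eq_forall_notMem [Fintype ι] (A : Finset ι) {m : ℕ}
    (h : A.card + m ≤ Fintype.card ι) : ∃ I : Finset ι, I.card = m ∧ ∀ i ∈ A, i ∉ I := by
  classical
  obtain ⟨I, hI, hcard⟩ := Finset.exists_subset_card_eq (s := Aᶜ) (n := m)
    (by rw [Finset.card_compl]; omega)
  exact ⟨I, hcard, fun i hi h => Finset.mem_compl.mp (hI h) hi⟩

theorem eigenvalue_eq_of_ev_eigen [Fintype ι] (hcard : d + 2 ≤ Fintype.card ι)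
    (hs : PairwiseIndep s) (hL : ∀ i p, ev (s i) (L p) = c i * ev (s i) p) (i j : ι) :
    c i = c j := by
  classical
  obtain ⟨D, hD, hDn⟩ := exists_card_eq_forall_notMem ({i, j} : Finset ι) (m := d)
    (by have := Finset.card_le_two (a := i) (b := j); omega)
  have hi : i ∉ D := hDn i (by simp)
  have hj : j ∉ D := hDn j (by simp)
  obtain ⟨κ, hκ⟩ := exists_map_prodForm_eq_smul hs hL hD hi
  have eq_κ {k : ι} (hk : k ∉ D) : c k = κ := by
    have h := hL k (prodForm s D hD)
    rw [hκ, map_smul, smul_eq_mul] at h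
    exact (mul_right_cancel₀ (hs.ev_prodForm_ne_zero hD hk) h).symm
  rw [eq_κ hi, eq_κ hj]

theorem eq_smul_of_ev_eigen [Fintype ι] (hcard : d + 2 ≤ Fintype.card ι) (hs : PairwiseIndep s)
    (hL : ∀ i p, ev (s i) (L p) = c i * ev (s i) p) (i : ι) (p : Form K d) : L p = c i • p := by
  obtain ⟨S, -, hS⟩ := Finset.exists_subset_card_eq (s := (Finset.univ : Finset ι)) (n := d + 1)
    (by rw [Finset.card_univ]; omega)
  refine sub_eq_zero.mp (eq_zero_of_ev_eq_zero hs hS fun j _ => ?_)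
  rw [map_sub, map_smul, smul_eq_mul, hL, eigenvalue_eq_of_ev_eigen hcard hs hL j i, sub_self]

theorem exists_mul_bracket_eq (hs : PairwiseIndep s) (ht : PairwiseIndep t) (hc : ∀ i, c i ≠ 0)
    (hL : ∀ i p, ev (s i) (L p) = c i * ev (t i) p) {I : Finset ι} (hI : I.card + 1 = d)
    {i j : ι} (hi : i ∉ I) (hj : j ∉ I) :
    ∃ x y : K, x ≠ 0 ∧ y ≠ 0 ∧ ∀ k ∉ I,
      x * (bracket (t i) (t k) * bracket (s j) (s k)) =
        y * (bracket (t j) (t k) * bracket (s i) (s k)) := by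
  classical
  have prod_ne_zero {r : ι → Fin 2 → K} (hr : PairwiseIndep r) {m : ι} (hm : m ∉ I) :
      ∏ l ∈ I, bracket (r m) (r l) ≠ 0 := by
    rw [← ev_prodForm r I rfl]
    exact hr.ev_prodForm_ne_zero rfl hm
  refine ⟨c i * (∏ l ∈ I, bracket (t i) (t l)) * ∏ l ∈ I, bracket (s j) (s l),
    c j * (∏ l ∈ I, bracket (t j) (t l)) * ∏ l ∈ I, bracket (s i) (s l),
    mul_ne_zero (mul_ne_zero (hc i) (prod_ne_zero ht hi)) (prod_ne_zero hs hj),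
    mul_ne_zero (mul_ne_zero (hc j) (prod_ne_zero ht hj)) (prod_ne_zero hs hi), fun k hk => ?_⟩
  obtain rfl | hik := eq_or_ne i k
  · simp only [bracket_self, zero_mul, mul_zero]
  have hD : (insert k I).card = d := by rw [Finset.card_insert_of_notMem hk, hI]
  obtain ⟨κ, hκ⟩ := exists_map_prodForm_eq_smul hs hL hD (b := i) (by simp [hik, hi])
  have ev_i := hL i (prodForm t (insert k I) hD)
  have ev_j := hL j (prodForm t (insert k I) hD)
  simp only [hκ, map_smul, smul_eq_mul, ev_prodForm, Finset.prod_insert hk] at ev_i ev_j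
  linear_combination
    (bracket (s i) (s k) * ∏ l ∈ I, bracket (s i) (s l)) * ev_j -
      (bracket (s j) (s k) * ∏ l ∈ I, bracket (s j) (s l)) * ev_i

theorem cross_ratio_eq [Fintype ι] (hd : 1 ≤ d) (hcard : d + 3 ≤ Fintype.card ι)
    (hs : PairwiseIndep s) (ht : PairwiseIndep t) (hc : ∀ i, c i ≠ 0)
    (hL : ∀ i p, ev (s i) (L p) = c i * ev (t i) p) (i j k l : ι) :
    bracket (t i) (t k) * bracket (t j) (t l) * (bracket (s j) (s k) * bracket (s i) (s l)) =
      bracket (t j) (t k) * bracket (t i) (t l) *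
        (bracket (s i) (s k) * bracket (s j) (s l)) := by
  classical
  obtain ⟨I, hI, hIn⟩ := exists_card_eq_forall_notMem ({i, j, k, l} : Finset ι) (m := d - 1)
    (by have := Finset.card_le_four (a := i) (b := j) (c := k) (d := l); omega)
  obtain ⟨x, y, hx, hy, hxy⟩ := exists_mul_bracket_eq hs ht hc hL (I := I) (by omega)
    (hIn i (by simp)) (hIn j (by simp))
  have hk := hxy k (hIn k (by simp))
  have hl := hxy l (hIn l (by simp))
  refine mul_left_cancel₀ (mul_ne_zero hx hy) ?_
  linear_combination
    (y * (bracket (t j) (t l) * bracket (s i) (s l))) * hk -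
      (y * (bracket (t j) (t k) * bracket (s i) (s k))) * hl

theorem mulVec_ne_zero {B : Matrix (Fin 2) (Fin 2) K} (hB : B.det ≠ 0) {v : Fin 2 → K}
    (hv : v ≠ 0) : B.mulVec v ≠ 0 := fun h =>
  hv (Matrix.eq_zero_of_mulVec_eq_zero hB h)

theorem exists_matrix_of_cross_ratio_eq (hs : PairwiseIndep s) (ht : PairwiseIndep t) {i j k : ι}
    (hij : i ≠ j) (hik : i ≠ k) (hjk : j ≠ k)
    (hst : ∀ l, bracket (t i) (t k) * bracket (t j) (t l) *
        (bracket (s j) (s k) * bracket (s i) (s l)) =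
      bracket (t j) (t k) * bracket (t i) (t l) *
        (bracket (s i) (s k) * bracket (s j) (s l))) :
    ∃ B : Matrix (Fin 2) (Fin 2) K, B.det ≠ 0 ∧
      ∀ l, ∃ δ : K, δ ≠ 0 ∧ t l = δ • B.mulVec (s l) := by
  have : Nontrivial ι := ⟨i, j, hij⟩
  set α := bracket (t k) (t j) * bracket (s i) (s k) with hα
  set β := bracket (t i) (t k) * bracket (s k) (s j) with hβ
  -- `B` maps `s i` to a multiple of `t i` and `s j` to one of `t j`; the weights `α` and `β` are
  -- such that it maps `s k` to a multiple of `t k`.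
  let B : Matrix (Fin 2) (Fin 2) K :=
    Matrix.of fun x y => α * t i x * ![s j 1, -s j 0] y + β * t j x * ![-s i 1, s i 0] y
  have hBv (v w : Fin 2 → K) : bracket (B.mulVec v) w =
      bracket v (s j) * α * bracket (t i) w + bracket (s i) v * β * bracket (t j) w := by
    simp only [bracket, B, Matrix.mulVec, dotProduct, Fin.sum_univ_two, Matrix.of_apply,
      Matrix.cons_val_zero, Matrix.cons_val_one]
    ring
  have hdet : B.det = α * β * (bracket (s i) (s j) * bracket (t i) (t j)) := by
    simp only [bracket, B, Matrix.det_fin_two, Matrix.of_apply,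
      Matrix.cons_val_zero, Matrix.cons_val_one]
    ring
  have hB : B.det ≠ 0 := by
    rw [hdet]
    exact mul_ne_zero (mul_ne_zero (mul_ne_zero (ht hjk.symm) (hs hik))
      (mul_ne_zero (ht hik) (hs hjk.symm))) (mul_ne_zero (hs hij) (ht hij))
  refine ⟨B, hB, fun l => ?_⟩
  have hl : bracket (t l) (B.mulVec (s l)) = 0 := by
    rw [bracket_swap, hBv, hα, hβ, bracket_swap (s l), bracket_swap (t k) (t j),
      bracket_swap (s k) (s j)]
    linear_combination hst l
  obtain ⟨δ, hδ⟩ := exists_eq_smul_of_bracket_eq_zero (mulVec_ne_zero hB (hs.ne_zero l)) hl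
  exact ⟨δ, fun h => ht.ne_zero l (by rw [hδ, h, zero_smul]), hδ⟩

theorem exists_eq_smul_compMatrix [Fintype ι] (hd : 1 ≤ d) (hcard : d + 3 ≤ Fintype.card ι)
    (hs : PairwiseIndep s) (ht : PairwiseIndep t) (hc : ∀ i, c i ≠ 0)
    (hL : ∀ i p, ev (s i) (L p) = c i * ev (t i) p) :
    ∃ (B : Matrix (Fin 2) (Fin 2) K) (κ : K),
      B.det ≠ 0 ∧ κ ≠ 0 ∧ ∀ p, L p = κ • compMatrix B p := by
  obtain ⟨i, j, k, hij, hik, hjk⟩ := Fintype.two_lt_card_iff.mp (show 2 < Fintype.card ι by omega)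
  obtain ⟨B, hB, htB⟩ := exists_matrix_of_cross_ratio_eq hs ht hij hik hjk
    (cross_ratio_eq hd hcard hs ht hc hL i j k)
  choose δ hδ htδ using htB
  let σ := compMatrixEquiv (d := d) B hB.isUnit
  have hLσ (l : ι) (p : Form K d) :
      ev (s l) ((L ∘ₗ σ.symm.toLinearMap) p) = (c l * δ l ^ d) * ev (s l) p := by
    obtain ⟨p, rfl⟩ := σ.surjective p
    rw [LinearMap.comp_apply, LinearEquiv.coe_coe, LinearEquiv.symm_apply_apply, hL, htδ, ev_smul,
      compMatrixEquiv_apply, ev_compMatrix, mul_assoc]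
  refine ⟨B, c i * δ i ^ d, hB, mul_ne_zero (hc i) (pow_ne_zero d (hδ i)), fun p => ?_⟩
  have h := eq_smul_of_ev_eigen (by omega) hs hLσ i (σ p)
  rwa [LinearMap.comp_apply, LinearEquiv.coe_coe, LinearEquiv.symm_apply_apply,
    compMatrixEquiv_apply] at h

end Uniqueness

section Curves

variable {K : Type*} [Field K] {ι : Type*} {n d : ℕ}

/-- The vector `(gᵢ(v))ᵢ` of values of a family of binary forms at `v`. For a basis `g` it
represents the point with parameter `v` of the normal rational curve `curve g`. -/
noncomputable def curveVec (g : ι → Form K d) (v : Fin 2 → K) : ι → K := fun i => ev v (g i)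

theorem curveVec_smul (g : ι → Form K d) (a : K) (v : Fin 2 → K) :
    curveVec g (a • v) = a ^ d • curveVec g v :=
  funext fun i => ev_smul a v (g i)

theorem curveVec_smul_compMatrix (g : ι → Form K d) (κ : K) (B : Matrix (Fin 2) (Fin 2) K)
    (v : Fin 2 → K) :
    curveVec (fun i => κ • compMatrix B (g i)) v = κ • curveVec g (B.mulVec v) :=
  funext fun i => by
    rw [curveVec, map_smul, ev_compMatrix, Pi.smul_apply, curveVec]

theorem curveVec_ne_zero (g : Module.Basis (Fin n) K (Form K (n - 1))) {v : Fin 2 → K}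
    (hv : v ≠ 0) : curveVec g v ≠ 0 :=
  eval_basis_ne_zero g v hv

theorem mk_mem_curve_iff (g : Module.Basis (Fin n) K (Form K (n - 1))) {x : Fin n → K}
    (hx : x ≠ 0) :
    Projectivization.mk K x hx ∈ curve g ↔ ∃ v ≠ 0, ∃ a : K, x = a • curveVec g v := by
  constructor
  · rintro ⟨v, hv, h⟩
    obtain ⟨a, ha⟩ := (Projectivization.mk_eq_mk_iff' K _ _ _ _).mp h
    exact ⟨v, hv, a, ha.symm⟩
  · rintro ⟨v, hv, a, ha⟩
    exact ⟨v, hv, (Projectivization.mk_eq_mk_iff' K _ _ _ _).mpr ⟨a, ha.symm⟩⟩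

theorem curve_eq_of_eq_smul_compMatrix {g g' : Module.Basis (Fin n) K (Form K (n - 1))}
    {B : Matrix (Fin 2) (Fin 2) K} {κ : K} (hB : B.det ≠ 0) (hκ : κ ≠ 0)
    (h : ∀ j, g' j = κ • compMatrix B (g j)) : curve g' = curve g := by
  have hvec (v : Fin 2 → K) : curveVec g' v = κ • curveVec g (B.mulVec v) := by
    rw [← curveVec_smul_compMatrix, ← funext h]
  ext P
  induction P using Projectivization.ind with | h x hx => ?_
  rw [mk_mem_curve_iff, mk_mem_curve_iff]
  constructor
  · rintro ⟨v, hv, a, rfl⟩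
    exact ⟨B.mulVec v, mulVec_ne_zero hB hv, a * κ, by rw [hvec, smul_smul]⟩
  · rintro ⟨v, hv, a, rfl⟩
    have hB' : B⁻¹.det ≠ 0 := (B.isUnit_nonsing_inv_det hB.isUnit).ne_zero
    refine ⟨B⁻¹.mulVec v, mulVec_ne_zero hB' hv, a * κ⁻¹, ?_⟩
    rw [hvec, Matrix.mulVec_mulVec, Matrix.mul_nonsing_inv B hB.isUnit, Matrix.one_mulVec,
      smul_smul, inv_mul_cancel_right₀ hκ]

theorem ev_equiv_of_curveVec_eq_smul {g g' : Module.Basis ι K (Form K d)} {v w : Fin 2 → K}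
    {c : K} (h : curveVec g' v = c • curveVec g w) (p : Form K d) :
    ev v (g.equiv g' (Equiv.refl ι) p) = c * ev w p := by
  have h' : ev v ∘ₗ (g.equiv g' (Equiv.refl ι)).toLinearMap = c • ev w :=
    g.ext fun i => by simpa [curveVec] using congrFun h i
  exact DFunLike.congr_fun h' p

theorem bracket_eq_zero_of_curveVec_eq_smul (hd : 1 ≤ d) (g : Module.Basis ι K (Form K d))
    {v w : Fin 2 → K} {c : K} (h : curveVec g v = c • curveVec g w) : bracket v w = 0 := by
  -- The form `bracket · w ^ d` vanishes at `w`, hence at `v`.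
  have h' := ev_equiv_of_curveVec_eq_smul h (prodForm (fun _ : Fin d => w) Finset.univ (by simp))
  rw [Module.Basis.equiv_refl, LinearEquiv.refl_apply, ev_prodForm, ev_prodForm,
    Finset.prod_const, Finset.prod_const, Finset.card_univ, Fintype.card_fin, bracket_self,
    zero_pow (by omega), mul_zero] at h'
  exact eq_zero_of_pow_eq_zero h'

theorem exists_eq_smul_compMatrix_of_curveVec_eq_smul [Fintype ι] (hn : 2 ≤ n)
    (hcard : n + 2 ≤ Fintype.card ι) {g g' : Module.Basis (Fin n) K (Form K (n - 1))}
    {s : ι → Fin 2 → K} (hs : PairwiseIndep s)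
    (h : ∀ i, ∃ t ≠ 0, ∃ a : K, curveVec g' (s i) = a • curveVec g t) :
    ∃ (B : Matrix (Fin 2) (Fin 2) K) (κ : K),
      B.det ≠ 0 ∧ κ ≠ 0 ∧ ∀ j, g' j = κ • compMatrix B (g j) := by
  choose t ht₀ c htc using h
  have : Nontrivial ι := Fintype.one_lt_card_iff_nontrivial.mp (by omega)
  have hc (i : ι) : c i ≠ 0 := fun h₀ =>
    curveVec_ne_zero g' (hs.ne_zero i) (by rw [htc, h₀, zero_smul])
  have ht : PairwiseIndep t := fun i j hij h₀ => by
    obtain ⟨a, ha⟩ := exists_eq_smul_of_bracket_eq_zero (ht₀ j) h₀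
    refine hs hij (bracket_eq_zero_of_curveVec_eq_smul (by omega) g'
      (c := c i * a ^ (n - 1) * (c j)⁻¹) ?_)
    rw [htc i, htc j, ha, curveVec_smul, smul_smul, smul_smul, inv_mul_cancel_right₀ (hc j)]
  obtain ⟨B, κ, hB, hκ, h⟩ := exists_eq_smul_compMatrix (by omega) (by omega) hs ht hc
    (L := (g.equiv g' (Equiv.refl _)).toLinearMap) fun i p => ev_equiv_of_curveVec_eq_smul (htc i) p
  refine ⟨B, κ, hB, hκ, fun j => ?_⟩
  rw [← h, LinearEquiv.coe_coe, Module.Basis.equiv_apply, Equiv.refl_apply]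

end Curves

section CoordinatewiseMap

variable {F K : Type*} [Field F] [Field K] {φ : F →+* K} {n d : ℕ}

theorem comp_ne_zero {ι : Type*} (φ : F →+* K) {x : ι → F} (hx : x ≠ 0) : φ ∘ x ≠ 0 := by
  obtain ⟨i, hi⟩ := Function.ne_iff.mp hx
  exact Function.ne_iff.mpr ⟨i, (map_ne_zero φ).mpr hi⟩

theorem curveVec_mapBasis {ι : Type*} [Fintype ι] (φ : F →+* K) (m : Module.Basis ι F (Form F d))
    (v : Fin 2 → F) : curveVec (mapBasis φ m) (φ ∘ v) = φ ∘ curveVec m v :=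
  funext fun i => by
    rw [curveVec, mapBasis_apply, ev_mapForm, Function.comp_apply, curveVec]

theorem PairwiseIndep.map {ι : Type*} {s : ι → Fin 2 → F} (hs : PairwiseIndep s) (φ : F →+* K) :
    PairwiseIndep fun i => φ ∘ s i := fun i j hij => by
  have h : bracket (φ ∘ s i) (φ ∘ s j) = φ (bracket (s i) (s j)) := by simp [bracket]
  exact ne_of_eq_of_ne h <| (map_ne_zero φ).mpr (hs hij)

theorem map_mk_curveVec (m : Module.Basis (Fin n) F (Form F (n - 1)))
    {f : (Fin n → F) →ₛₗ[φ] (Fin n → K)} (hf : Function.Injective f) (hfφ : ∀ x, f x = φ ∘ x)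
    {v : Fin 2 → F} (hv : v ≠ 0) :
    Projectivization.map f hf (.mk F (curveVec m v) (curveVec_ne_zero m hv)) =
      .mk K (curveVec (mapBasis φ m) (φ ∘ v)) (curveVec_ne_zero _ (comp_ne_zero φ hv)) := by
  simp only [Projectivization.map_mk, curveVec_mapBasis, hfφ]

theorem image_curve_subset (m : Module.Basis (Fin n) F (Form F (n - 1)))
    {f : (Fin n → F) →ₛₗ[φ] (Fin n → K)} (hf : Function.Injective f) (hfφ : ∀ x, f x = φ ∘ x) :
    Projectivization.map f hf '' curve m ⊆ curve (mapBasis φ m) := by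
  rintro _ ⟨_, ⟨v, hv, rfl⟩, rfl⟩
  exact ⟨φ ∘ v, comp_ne_zero φ hv, map_mk_curveVec m hf hfφ hv⟩

theorem image_curve_eq (m : Module.Basis (Fin n) F (Form F (n - 1)))
    {f : (Fin n → F) →ₛₗ[φ] (Fin n → K)} (hf : Function.Injective f) (hfφ : ∀ x, f x = φ ∘ x)
    (hφ : Function.Surjective φ) :
    Projectivization.map f hf '' curve m = curve (mapBasis φ m) := by
  refine (image_curve_subset m hf hfφ).antisymm ?_
  rintro _ ⟨w, hw, rfl⟩
  obtain ⟨v, rfl⟩ := hφ.comp_left w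
  have hv : v ≠ 0 := by rintro rfl; exact hw (by ext; simp)
  exact ⟨_, ⟨v, hv, rfl⟩, map_mk_curveVec m hf hfφ hv⟩

end CoordinatewiseMap

section SemilinearDescent

variable {K V : Type*} [Field K] [AddCommGroup V] [Module K V]

theorem iterate_smulₛₗ {A : Type*} [CommSemiring A] [Algebra A K] {σ : K →ₐ[A] K}
    (T : V →ₛₗ[(σ : K →+* K)] V) (m : ℕ) (a : K) (v : V) :
    T^[m] (a • v) = (σ ^ m) a • T^[m] v := by
  induction m with
  | zero => simp
  | succ m ih =>
    rw [Function.iterate_succ_apply', ih, map_smulₛₗ, Function.iterate_succ_apply', pow_succ']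
    rfl

theorem span_fixed_eq_top {A : Type*} [CommSemiring A] [Algebra A K] {σ : K →ₐ[A] K}
    (hσ : 0 < orderOf σ) (T : V →ₛₗ[(σ : K →+* K)] V) (hT : ∀ v, T^[orderOf σ] v = v) :
    Submodule.span K {v | T v = v} = ⊤ := by
  by_contra hne
  obtain ⟨f, hf, hker⟩ := Submodule.exists_le_ker_of_lt_top _ (lt_top_iff_ne_top.mpr hne)
  -- The traces `∑ i, T^[i] (a • v)` are fixed by `T`, and the characters `σ ^ i` are independent.
  have fixed_trace (v : V) : T (∑ i ∈ Finset.range (orderOf σ), T^[i] v) =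
      ∑ i ∈ Finset.range (orderOf σ), T^[i] v := by
    have h := Finset.sum_range_succ' (fun i => T^[i] v) (orderOf σ)
    rw [Finset.sum_range_succ, hT, Function.iterate_zero_apply] at h
    rw [map_sum]
    simpa only [← Function.iterate_succ_apply' T] using (add_right_cancel h).symm
  have trace_eq_zero (a : K) (v : V) :
      ∑ i ∈ Finset.range (orderOf σ), f (T^[i] v) * (σ ^ i) a = 0 := by
    have h : f (∑ i ∈ Finset.range (orderOf σ), T^[i] (a • v)) = 0 :=
      hker (Submodule.subset_span (fixed_trace (a • v)))
    simpa only [map_sum, iterate_smulₛₗ, map_smul, smul_eq_mul, mul_comm] using h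
  have injOn_pow : Set.InjOn (fun i => ((σ ^ i : K →ₐ[A] K) : K →* K))
      (Finset.range (orderOf σ)) := fun i hi j hj hij =>
    pow_injOn_Iio_orderOf (by simpa using hi) (by simpa using hj)
      (AlgHom.ext fun x => DFunLike.congr_fun hij x)
  refine hf (LinearMap.ext fun v => ?_)
  exact linearIndepOn_finset_iff.mp
    (((linearIndependent_monoidHom K K).linearIndepOn _).comp_of_image injOn_pow)
    (fun i => f (T^[i] v)) (funext fun a => by simpa using trace_eq_zero a v)
    0 (Finset.mem_range.mpr hσ)

theorem iterate_smul_eq_prod_smul_iterate {A : Type*} [CommSemiring A] [Algebra A K] {σ : K →ₐ[A] K}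
    (T : V →ₛₗ[(σ : K →+* K)] V) (μ : K) (m : ℕ) (v : V) :
    (fun w => μ • T w)^[m] v = (∏ i ∈ Finset.range m, (σ ^ i) μ) • T^[m] v := by
  induction m with
  | zero => simp
  | succ m ih =>
    rw [Function.iterate_succ_apply', ih, map_smulₛₗ, Finset.prod_range_succ', smul_smul,
      Function.iterate_succ_apply', pow_zero, AlgHom.one_apply, mul_comm]
    simp only [RingHom.coe_coe, map_prod, pow_succ', AlgHom.mul_apply]

theorem exists_matrix_of_span_eq_top {n : ℕ} {S : Set (Fin n → K)} (hS : Submodule.span K S = ⊤) :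
    ∃ A : Matrix (Fin n) (Fin n) K, A.det ≠ 0 ∧ ∀ j, A.col j ∈ S := by
  obtain ⟨b, hb, -, hli⟩ := Submodule.exists_fun_fin_finrank_span_eq K S
  have hcard : n = Module.finrank K (Submodule.span K S) := by
    rw [hS, finrank_top, Module.finrank_fin_fun]
  let A : Matrix (Fin n) (Fin n) K := (Matrix.of (b ∘ Fin.cast hcard)).transpose
  have hA : IsUnit A := Matrix.linearIndependent_cols_iff_isUnit.mp
    (hli.comp _ (Fin.cast_injective hcard))
  exact ⟨A, (A.isUnit_iff_isUnit_det.mp hA).ne_zero, fun j => hb _⟩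

end SemilinearDescent

section FrobeniusDescent

variable (F : Type*) {K V : Type*} [Field F] [Fintype F] [Field K] [Finite K] [Algebra F K]
  [AddCommGroup V] [Module K V]

/-- The Frobenius automorphism `x ↦ x ^ |F|` of an extension of the finite field `F`, as the ring
homomorphism over which the Frobenius collineation is semilinear. -/
noncomputable abbrev frob (F K : Type*) [Field F] [Fintype F] [Field K] [Algebra F K] : K →+* K :=
  (FiniteField.frobeniusAlgHom F K : K →+* K)

theorem frob_eq_self_iff {x : K} : frob F K x = x ↔ x ∈ (algebraMap F K).range := by
  refine ⟨fun hx => (IsGalois.mem_range_algebraMap_iff_fixed x).mpr fun τ => ?_, ?_⟩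
  · obtain ⟨i, rfl⟩ := (FiniteField.bijective_frobeniusAlgEquivOfAlgebraic_pow F K).2 τ
    rw [AlgEquiv.coe_pow]
    exact Function.iterate_fixed hx i
  · rintro ⟨y, rfl⟩
    exact (FiniteField.frobeniusAlgHom F K).commutes y

variable {F}

theorem iterate_frob_finrank : (frob F K)^[Module.finrank F K] = id := funext fun x => by
  have h := DFunLike.congr_fun (pow_orderOf_eq_one (FiniteField.frobeniusAlgHom F K)) x
  rwa [FiniteField.orderOf_frobeniusAlgHom, AlgHom.coe_pow] at h

theorem exists_iterate_finrank_eq_smul (T : V →ₛₗ[frob F K] V)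
    (hT : ∀ v, ∃ a : K, T^[Module.finrank F K] v = a • v) :
    ∃ τ : K, ∀ v, T^[Module.finrank F K] v = τ • v := by
  let L : V →ₗ[K] V :=
    { toFun := T^[Module.finrank F K]
      map_add' := iterate_map_add T _
      map_smul' := fun a v => by
        rw [iterate_smulₛₗ, AlgHom.coe_pow]
        exact congrArg (· • _) (congrFun iterate_frob_finrank a) }
  obtain ⟨τ, hτ⟩ := L.exists_eq_smul_id_of_forall_notLinearIndependent fun v hv => by
    obtain ⟨a, ha⟩ := hT v
    exact (LinearIndependent.pair_iff' (hv.ne_zero 0)).mp hv a ha.symm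
  exact ⟨τ, LinearMap.congr_fun hτ⟩

theorem frob_eq_self_of_iterate_finrank_eq_smul [Nontrivial V] (T : V →ₛₗ[frob F K] V) {τ : K}
    (hτ : τ ≠ 0) (hT : ∀ v, T^[Module.finrank F K] v = τ • v) : frob F K τ = τ := by
  obtain ⟨u, hu⟩ := exists_ne (0 : V)
  have hTu : T u ≠ 0 := fun h => by
    have h' : T^[Module.finrank F K] u = 0 := by
      obtain ⟨m, hm⟩ := Nat.exists_eq_succ_of_ne_zero (Module.finrank_pos (R := F) (M := K)).ne'
      rw [hm, Function.iterate_succ_apply, h, iterate_map_zero]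
    exact smul_ne_zero hτ hu (hT u ▸ h')
  have h : T (T^[Module.finrank F K] u) = T^[Module.finrank F K] (T u) := by
    rw [← Function.iterate_succ_apply, ← Function.iterate_succ_apply' T]
  rw [hT, hT, map_smulₛₗ] at h
  exact smul_left_injective K hTu h

theorem exists_prod_frob_mul_algebraMap_eq_one {y : F} (hy : y ≠ 0) :
    ∃ μ : K, μ ≠ 0 ∧ (∏ i ∈ Finset.range (Module.finrank F K),
      (FiniteField.frobeniusAlgHom F K ^ i) μ) * algebraMap F K y = 1 := by
  obtain ⟨μ, hμ⟩ := FiniteField.norm_surjective F K y⁻¹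
  refine ⟨μ, Algebra.norm_ne_zero_iff.mp (hμ ▸ inv_ne_zero hy), ?_⟩
  rw [← mul_inv_cancel₀ ((map_ne_zero (algebraMap F K)).mpr hy), ← map_inv₀, ← hμ,
    FiniteField.algebraMap_norm_eq_prod_pow, mul_comm]
  simp only [AlgHom.coe_pow, FiniteField.coe_frobeniusAlgHom, pow_iterate,
    Nat.card_eq_fintype_card]

theorem exists_span_eigenvectors_eq_top [Nontrivial V] (T : V →ₛₗ[frob F K] V) {τ : K}
    (hτ : τ ≠ 0) (hT : ∀ v, T^[Module.finrank F K] v = τ • v) :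
    ∃ ν : K, Submodule.span K {v | T v = ν • v} = ⊤ := by
  obtain ⟨y, rfl⟩ := (frob_eq_self_iff F).mp (frob_eq_self_of_iterate_finrank_eq_smul T hτ hT)
  -- Scaling `T` by an element of norm `y⁻¹` makes its order divide `[K : F]`.
  obtain ⟨μ, hμ₀, hμ⟩ := exists_prod_frob_mul_algebraMap_eq_one (K := K)
    (show y ≠ 0 by rintro rfl; exact hτ (map_zero _))
  have hfix := span_fixed_eq_top (σ := FiniteField.frobeniusAlgHom F K)
    (by rw [FiniteField.orderOf_frobeniusAlgHom]; exact Module.finrank_pos) (μ • T) fun v => by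
      have h := iterate_smul_eq_prod_smul_iterate T μ (Module.finrank F K) v
      rw [hT, smul_smul, hμ, one_smul] at h
      rwa [FiniteField.orderOf_frobeniusAlgHom]
  refine ⟨μ⁻¹, ?_⟩
  convert hfix using 4 with v
  rw [LinearMap.smul_apply, eq_inv_smul_iff₀ hμ₀]

end FrobeniusDescent

section CurveDescent

variable {F K : Type*} [Field F] [Fintype F] [Field K] [Algebra F K] {ι : Type*} {d : ℕ}

/-- The Frobenius-semilinear map `v ↦ B v^σ` of the plane, `σ` the Frobenius automorphism. -/
noncomputable def mulVecFrob (F : Type*) [Field F] [Fintype F] [Algebra F K]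
    (B : Matrix (Fin 2) (Fin 2) K) : (Fin 2 → K) →ₛₗ[frob F K] (Fin 2 → K) :=
  B.mulVecLin.comp (frobeniusVec F K 2)

theorem mulVecFrob_apply (B : Matrix (Fin 2) (Fin 2) K) (v : Fin 2 → K) :
    mulVecFrob F B v = B.mulVec (frob F K ∘ v) := rfl

theorem curveVec_iterate_mulVecFrob {g : ι → Form K d} {B : Matrix (Fin 2) (Fin 2) K} {κ : K}
    (h : ∀ j, mapForm (frob F K) (g j) = κ • compMatrix B (g j)) (m : ℕ) :
    ∃ c : K, ∀ v, (frob F K)^[m] ∘ curveVec g v = c • curveVec g ((mulVecFrob F B)^[m] v) := by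
  have step (v : Fin 2 → K) :
      frob F K ∘ curveVec g v = κ • curveVec g (mulVecFrob F B v) := funext fun j => by
    rw [Function.comp_apply, curveVec, ← ev_mapForm, h, map_smul, ev_compMatrix, mulVecFrob_apply,
      Pi.smul_apply, curveVec]
  induction m with
  | zero => exact ⟨1, fun v => by simp⟩
  | succ m ih =>
    obtain ⟨c, hc⟩ := ih
    refine ⟨frob F K c * κ, fun v => ?_⟩
    rw [Function.iterate_succ', Function.comp_assoc, hc, Function.iterate_succ_apply', mul_smul,
      ← step]
    exact funext fun j => map_mul (frob F K) c _

variable [Finite K]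

theorem exists_mapBasis_smul_eq [Fintype ι] {g : Module.Basis ι K (Form K d)} {κ : K}
    (hg : ∀ j, mapForm (frob F K) (g j) = κ • g j) :
    ∃ (δ : K) (m : Module.Basis ι F (Form F d)),
      δ ≠ 0 ∧ ∀ j, g j = δ • mapBasis (algebraMap F K) m j := by
  have frob_repr (j : ι) (e : {e : Fin 2 →₀ ℕ | e.degree = d}) :
      frob F K ((formBasis K d).repr (g j) e) = κ * (formBasis K d).repr (g j) e := by
    have h := congrArg (fun p => (formBasis K d).repr p e) (hg j)
    rwa [map_smul, Finsupp.smul_apply, smul_eq_mul, formBasis_repr_apply, coe_mapForm,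
      coeff_map, ← formBasis_repr_apply] at h
  obtain ⟨j₀⟩ : Nonempty ι := by
    rw [← Fintype.card_pos_iff, ← Module.finrank_eq_card_basis g, finrank_form]
    exact d.succ_pos
  obtain ⟨e₀, he₀⟩ : ∃ e, (formBasis K d).repr (g j₀) e ≠ 0 :=
    Finsupp.ne_iff.mp ((formBasis K d).repr.map_ne_zero_iff.mpr (g.ne_zero j₀))
  set δ := (formBasis K d).repr (g j₀) e₀ with hδ
  -- All coefficients of the forms `g j` are multiplied by `κ` under Frobenius, so their ratios are
  -- fixed.
  have hκ : κ ≠ 0 := fun h => he₀ ((map_eq_zero (frob F K)).mp (by rw [frob_repr, h, zero_mul]))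
  let g' : Module.Basis ι K (Form K d) := g.unitsSMul fun _ => (Units.mk0 δ he₀)⁻¹
  have hg' (j : ι) : g' j = δ⁻¹ • g j := by
    rw [Module.Basis.unitsSMul_apply, Units.smul_def, Units.val_inv_eq_inv_val, Units.val_mk0]
  obtain ⟨m, hm⟩ := exists_mapBasis_eq (φ := algebraMap F K) (g := g') fun j => by
    refine exists_mapForm_eq fun e => (frob_eq_self_iff F).mp ?_
    rw [hg', map_smul, Finsupp.smul_apply, smul_eq_mul, map_mul, map_inv₀, frob_repr, hδ,
      frob_repr, mul_inv, mul_mul_mul_comm, inv_mul_cancel₀ hκ, one_mul]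
  exact ⟨δ, m, he₀, fun j => by rw [hm, hg', smul_inv_smul₀ he₀]⟩

theorem exists_iterate_mulVecFrob_eq_smul (hd : 1 ≤ d) {g : Module.Basis ι K (Form K d)}
    {B : Matrix (Fin 2) (Fin 2) K} (hB : B.det ≠ 0) {κ : K}
    (h : ∀ j, mapForm (frob F K) (g j) = κ • compMatrix B (g j)) :
    ∃ τ : K, τ ≠ 0 ∧ ∀ v, (mulVecFrob F B)^[Module.finrank F K] v = τ • v := by
  obtain ⟨c, hc⟩ := curveVec_iterate_mulVecFrob h (Module.finrank F K)
  simp only [iterate_frob_finrank, Function.id_comp] at hc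
  obtain ⟨τ, hτ⟩ := exists_iterate_finrank_eq_smul (mulVecFrob F B) fun v => by
    obtain rfl | hv := eq_or_ne v 0
    · exact ⟨0, by rw [iterate_map_zero, zero_smul]⟩
    · refine exists_eq_smul_of_bracket_eq_zero hv ?_
      rw [bracket_swap, bracket_eq_zero_of_curveVec_eq_smul hd g (hc v), neg_zero]
  refine ⟨τ, ?_, hτ⟩
  rintro rfl
  have mulVecFrob_injective : Function.Injective (mulVecFrob F B) :=
    (Matrix.mulVec_injective_iff_isUnit.mpr (B.isUnit_iff_isUnit_det.mpr hB.isUnit)).comp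
      (frobeniusVec_injective F K 2)
  obtain ⟨v, hv⟩ := exists_ne (0 : Fin 2 → K)
  exact hv (mulVecFrob_injective.iterate _ (by rw [hτ, zero_smul, iterate_map_zero]))

theorem exists_compMatrix_eq_smul_of_mapForm_eq (hd : 1 ≤ d) {g : Module.Basis ι K (Form K d)}
    {B : Matrix (Fin 2) (Fin 2) K} (hB : B.det ≠ 0) {κ : K}
    (h : ∀ j, mapForm (frob F K) (g j) = κ • compMatrix B (g j)) :
    ∃ (A : Matrix (Fin 2) (Fin 2) K) (κ' : K), A.det ≠ 0 ∧
      ∀ j, mapForm (frob F K) (compMatrix A (g j)) = κ' • compMatrix A (g j) := by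
  obtain ⟨τ, hτ, hBτ⟩ := exists_iterate_mulVecFrob_eq_smul hd hB h
  obtain ⟨ν, hν⟩ := exists_span_eigenvectors_eq_top (mulVecFrob F B) hτ hBτ
  obtain ⟨A, hA, hcol⟩ := exists_matrix_of_span_eq_top hν
  have hBA : B * A.map (frob F K) = ν • A := by
    ext i j
    exact congrFun (hcol j) i
  refine ⟨A, κ * ν ^ d, hA, fun j => ?_⟩
  rw [mapForm_compMatrix, h, map_smul, compMatrix_compMatrix, hBA, compMatrix_smul, smul_smul]

end CurveDescent

section CurvesOverSubfields

variable {F K : Type*} [Field F] [Field K] {d : ℕ}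

theorem exists_eq_smul_comp_of_mul_ev_mem_range {φ : F →+* K} (hd : 1 ≤ d) {v : Fin 2 → K}
    (hv : v ≠ 0) {a : K} (ha : a ≠ 0) (h : ∀ p : Form F d, a * ev v (mapForm φ p) ∈ φ.fieldRange) :
    ∃ (c : K) (w : Fin 2 → F), v = c • (φ ∘ w) := by
  obtain ⟨i, hi : v i ≠ 0⟩ := Function.ne_iff.mp hv
  -- The ratio `v j / v i` is that of the values of the forms `X i ^ (d - 1) * X j` and `X i ^ d`.
  have hrange (j : Fin 2) : v j / v i ∈ φ.fieldRange := by
    have hform (j : Fin 2) : (X i ^ (d - 1) * X j : MvPolynomial (Fin 2) F) ∈ Form F d := by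
      have h := (isHomogeneous_X_pow (R := F) i (d - 1)).mul (isHomogeneous_X F j)
      rwa [Nat.sub_add_cancel hd] at h
    have hmem (j : Fin 2) : a * (v i ^ (d - 1) * v j) ∈ φ.fieldRange := by
      have h := h ⟨_, hform j⟩
      rwa [ev_apply, coe_mapForm, map_mul, map_pow, map_X, map_X, map_mul, map_pow, eval_X,
        eval_X] at h
    have h := div_mem (hmem j) (hmem i)
    rwa [← mul_assoc, ← mul_assoc, mul_div_mul_left] at h
    exact mul_ne_zero ha (pow_ne_zero _ hi)
  choose w hw using hrange
  refine ⟨v i, w, funext fun j => ?_⟩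
  rw [Pi.smul_apply, Function.comp_apply, hw, smul_eq_mul, mul_div_cancel₀ _ hi]

theorem mul_ev_mapForm_mem_fieldRange {ι : Type*} {φ : F →+* K}
    (m : Module.Basis ι F (Form F d)) {v : Fin 2 → K} {a : K}
    (h : ∀ i, a * ev v (mapForm φ (m i)) ∈ φ.fieldRange) (p : Form F d) :
    a * ev v (mapForm φ p) ∈ φ.fieldRange := by
  induction m.mem_span p using Submodule.span_induction with
  | mem _ hp =>
    obtain ⟨i, rfl⟩ := hp
    exact h i
  | zero => simp [zero_mem]
  | add p r _ _ hp hr => rw [map_add, map_add, mul_add]; exact add_mem hp hr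
  | smul b p _ hp =>
    rw [map_smulₛₗ, map_smul, smul_eq_mul, mul_left_comm]
    exact mul_mem ⟨b, rfl⟩ hp

variable [Algebra F K] {n : ℕ}

theorem curve_mapBasis_inter_subgeometry (hn : 2 ≤ n)
    (m : Module.Basis (Fin n) F (Form F (n - 1))) :
    curve (mapBasis (algebraMap F K) m) ∩ subgeometry F K n =
      subgeometryEmbedding F K n '' curve m := by
  refine (Set.subset_inter ?_ (Set.image_subset_range _ _)).antisymm' ?_
  · exact image_curve_subset m (inclusion_injective F K n) fun _ => rfl
  rintro _ ⟨⟨v, hv, hvP⟩, Q, rfl⟩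
  induction Q using Projectivization.ind with | h y hy => ?_
  obtain ⟨a, ha⟩ : ∃ a : Kˣ, a • curveVec (mapBasis (algebraMap F K) m) v = algebraMap F K ∘ y :=
    (Projectivization.mk_eq_mk_iff K _ _ _ _).mp hvP
  obtain ⟨c, w, rfl⟩ := exists_eq_smul_comp_of_mul_ev_mem_range (by omega) hv a.ne_zero <|
    mul_ev_mapForm_mem_fieldRange m fun i => by
      rw [← mapBasis_apply]
      exact ⟨y i, (congrFun ha i).symm⟩
  have hw : w ≠ 0 := by
    rintro rfl
    exact hv (by ext; simp)
  refine ⟨_, ⟨w, hw, rfl⟩, ?_⟩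
  refine (map_mk_curveVec m (inclusion_injective F K n) (fun _ => rfl) hw).trans ?_
  refine ((Projectivization.mk_eq_mk_iff' K _ _ _ _).mpr ⟨a * c ^ (n - 1), ?_⟩).symm
  rw [mul_smul, ← curveVec_smul]
  exact ha

/-- Representatives of the points of the projective line over `F`. -/
def linePoint (F : Type*) [Field F] : Option F → Fin 2 → F
  | none => ![1, 0]
  | some a => ![a, 1]

theorem pairwiseIndep_linePoint (F : Type*) [Field F] : PairwiseIndep (linePoint F) := by
  rintro (_ | a) (_ | b) hab
  · exact absurd rfl hab
  · simp [linePoint, bracket]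
  · simp [linePoint, bracket]
  · simpa [linePoint, bracket, sub_eq_zero] using hab

end CurvesOverSubfields

section Invariance

variable {F K : Type*} [Field F] [Fintype F] [Field K] [Algebra F K] {n : ℕ}

theorem curve_eq_curve_mapBasis_of_image_subset (hn : 2 ≤ n) (hF : n + 1 ≤ Fintype.card F)
    {g : Module.Basis (Fin n) K (Form K (n - 1))} {m : Module.Basis (Fin n) F (Form F (n - 1))}
    (h : subgeometryEmbedding F K n '' curve m ⊆ curve g) :
    curve g = curve (mapBasis (algebraMap F K) m) := by
  have hs := pairwiseIndep_linePoint F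
  obtain ⟨B, κ, hB, hκ, hBκ⟩ := exists_eq_smul_compMatrix_of_curveVec_eq_smul hn
    (by rw [Fintype.card_option]; omega) (g := g) (g' := mapBasis (algebraMap F K) m)
    (hs.map (algebraMap F K)) fun i => by
      rw [← mk_mem_curve_iff g (curveVec_ne_zero _ (comp_ne_zero _ (hs.ne_zero i))),
        ← map_mk_curveVec m (inclusion_injective F K n) (fun _ => rfl) (hs.ne_zero i)]
      exact h ⟨_, ⟨_, hs.ne_zero i, rfl⟩, rfl⟩
  exact (curve_eq_of_eq_smul_compMatrix hB hκ hBκ).symm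

theorem mapBasis_frob_mapBasis {ι : Type*} [Fintype ι] {d : ℕ}
    (m : Module.Basis ι F (Form F d)) :
    mapBasis (frob F K) (mapBasis (algebraMap F K) m) = mapBasis (algebraMap F K) m :=
  Module.Basis.eq_of_apply_eq fun j => by
    rw [mapBasis_apply, mapBasis_apply, mapForm_mapForm, AlgHom.comp_algebraMap]

variable [Finite K]

theorem image_frobeniusCollineation_curve (g : Module.Basis (Fin n) K (Form K (n - 1))) :
    frobeniusCollineation F K n '' curve g = curve (mapBasis (frob F K) g) :=
  image_curve_eq g (frobeniusVec_injective F K n) (fun _ => rfl)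
    (Finite.surjective_of_injective (frob F K).injective)

theorem exists_curve_eq_curve_mapBasis (hn : 2 ≤ n) (hK : n + 1 ≤ Nat.card K)
    {g : Module.Basis (Fin n) K (Form K (n - 1))}
    (h : frobeniusCollineation F K n '' curve g = curve g) :
    ∃ m : Module.Basis (Fin n) F (Form F (n - 1)),
      curve g = curve (mapBasis (algebraMap F K) m) := by
  have := Fintype.ofFinite K
  have hs := pairwiseIndep_linePoint K
  obtain ⟨B, κ, hB, -, hBκ⟩ := exists_eq_smul_compMatrix_of_curveVec_eq_smul hn
    (by rw [Fintype.card_option, ← Nat.card_eq_fintype_card]; omega)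
    (g := g) (g' := mapBasis (frob F K) g) hs fun i => by
      rw [← mk_mem_curve_iff g (curveVec_ne_zero _ (hs.ne_zero i)), ← h,
        image_frobeniusCollineation_curve]
      exact ⟨_, hs.ne_zero i, rfl⟩
  simp only [mapBasis_apply] at hBκ
  obtain ⟨A, κ', hA, hAκ⟩ := exists_compMatrix_eq_smul_of_mapForm_eq (by omega) hB hBκ
  let gA := g.map (compMatrixEquiv A hA.isUnit)
  have hgA (j : Fin n) : gA j = compMatrix A (g j) := Module.Basis.map_apply _ _ _
  obtain ⟨δ, m, hδ, hm⟩ := exists_mapBasis_smul_eq (g := gA) fun j => by rw [hgA, hAκ]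
  refine ⟨m, ?_⟩
  calc
    curve g = curve gA :=
      (curve_eq_of_eq_smul_compMatrix hA one_ne_zero fun j => by rw [hgA, one_smul]).symm
    _ = curve (mapBasis (algebraMap F K) m) :=
      curve_eq_of_eq_smul_compMatrix (B := 1) (by simp) hδ fun j => by rw [compMatrix_one, hm]

end Invariance

section Nonempty

variable {K : Type*} [Field K] {n : ℕ}

theorem IsNormalRationalCurve.nonempty {N : Set (ℙ K (Fin n → K))} (hN : IsNormalRationalCurve N) :
    N.Nonempty := by
  obtain ⟨g, rfl⟩ := hN
  obtain ⟨v, hv⟩ := exists_ne (0 : Fin 2 → K)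
  exact ⟨_, v, hv, rfl⟩

theorem IsNormalRationalCurve.pos {N : Set (ℙ K (Fin n → K))} (hN : IsNormalRationalCurve N) :
    0 < n := by
  obtain ⟨g, -⟩ := hN
  have h := Module.finrank_eq_card_basis g
  rw [finrank_form, Fintype.card_fin] at h
  omega

theorem exists_isNormalRationalCurve (K : Type*) [Field K] {n : ℕ} (hn : 0 < n) :
    ∃ N : Set (ℙ K (Fin n → K)), IsNormalRationalCurve N :=
  ⟨_, Module.finBasisOfFinrankEq K (Form K (n - 1)) (by rw [finrank_form]; omega), rfl⟩

end Nonempty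

instance {K : Type*} [Field K] : Subsingleton (ℙ K (Fin 1 → K)) where
  allEq P Q := by
    induction P using Projectivization.ind with | h x hx => ?_
    induction Q using Projectivization.ind with | h y hy => ?_
    have hy₀ : y 0 ≠ 0 := fun h => hy (funext fun i => by rwa [Subsingleton.elim i 0])
    refine (Projectivization.mk_eq_mk_iff' K x y hx hy).mpr ⟨x 0 / y 0, funext fun i => ?_⟩
    rw [Subsingleton.elim i 0, Pi.smul_apply, smul_eq_mul, div_mul_cancel₀ _ hy₀]

end NRC

theorem mainTheorem8_general {F K : Type*} [Field F] [Fintype F] [Field K] [Finite K] [Algebra F K]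
    {n : ℕ} (hF : n + 1 ≤ Fintype.card F) {N : Set (ℙ K (Fin n → K))}
    (hN : NRC.IsNormalRationalCurve N) :
    (∃ M : Set (ℙ F (Fin n → F)), NRC.IsNormalRationalCurve M ∧
      N ∩ NRC.subgeometry F K n = NRC.subgeometryEmbedding F K n '' M) ↔
    NRC.frobeniusCollineation F K n '' N = N := by
  obtain rfl | hn : n = 1 ∨ 2 ≤ n := by have := hN.pos; omega
  · obtain ⟨M, hM⟩ := NRC.exists_isNormalRationalCurve F one_pos
    refine iff_of_true ⟨M, hM, ?_⟩ ?_
    · rw [hN.nonempty.eq_univ, hM.nonempty.eq_univ, Set.univ_inter, Set.image_univ,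
        NRC.subgeometry]
    · rw [hN.nonempty.eq_univ, (Set.univ_nonempty.image _).eq_univ]
  obtain ⟨g, rfl⟩ := hN
  constructor
  · rintro ⟨_, ⟨m, rfl⟩, h⟩
    rw [NRC.curve_eq_curve_mapBasis_of_image_subset hn hF (h ▸ Set.inter_subset_left),
      NRC.image_frobeniusCollineation_curve, NRC.mapBasis_frob_mapBasis]
  · intro h
    have hK : Fintype.card F ≤ Nat.card K := by
      rw [← Nat.card_eq_fintype_card]
      exact Nat.card_le_card_of_injective _ (algebraMap F K).injective
    obtain ⟨m, hm⟩ := NRC.exists_curve_eq_curve_mapBasis hn (hF.trans hK) h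
    exact ⟨_, ⟨m, rfl⟩, by rw [hm, NRC.curve_mapBasis_inter_subgeometry hn]⟩

theorem mainTheorem8 (q h k : ℕ) (hh : 0 < h) (hk : 0 < k) (hq : h * k + 1 ≤ q)
    (F K : Type*) [Field F] [Fintype F] [Field K] [Fintype K] [Algebra F K]
    (hF : Fintype.card F = q) (hK : Fintype.card K = q ^ h)
    (N : Set (ℙ K (Fin (h * k) → K))) (hN : NRC.IsNormalRationalCurve N) :
    (∃ M : Set (ℙ F (Fin (h * k) → F)), NRC.IsNormalRationalCurve M ∧
      N ∩ NRC.subgeometry F K (h * k) = NRC.subgeometryEmbedding F K (h * k) '' M) ↔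
    NRC.frobeniusCollineation F K (h * k) '' N = N :=
  mainTheorem8_general (hF ▸ hq) hN
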